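/- For a positive integer $N$ let $p(N)$ denote the number of primitive vectors of norm $N$ in $\mathbb{Z}^3$, that is, the number of triples $(x,y,z)\in\mathbb{Z}^3$ with $\gcd(x,y,z)=1$ and $x^2+y^2+z^2=N$. Let $m,n\ge 1$ be integers with $n$ squarefree. If $m$ is odd, then \[ p(nm^2)=p(n)\prod_{p^\ell\,\|\,m}\Big(p^\ell-\Big(\frac{-n}{p}\Big)p^{\ell-1}\Big), \] where $p^\ell$ runs over the prime powers (with $\ell\ge 1$) in the canonical factorization of $m$, and $\big(\frac{-n}{p}\big)$ is the Legendre symbol (which is $0$ if $p\mid n$). If $m$ is even, then $p(nm^2)=0$. -/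

import Mathlib

/-- The set of primitive vectors of norm `N` in `ℤ³`: integral vectors whose three
coordinates are relatively prime, and the sum of whose squares is `N`. -/
def primitiveVectors (N : ℕ) : Set (Fin 3 → ℤ) :=
  {v | ∑ i, v i ^ 2 = (N : ℤ) ∧ Finset.univ.gcd v = 1}

/-- There are only finitely many primitive vectors of a given norm, so that counting
them with `Set.ncard` makes sense. -/
theorem primitiveVectors_finite (N : ℕ) : (primitiveVectors N).Finite := by
  refine (Set.finite_Icc (fun _ : Fin 3 => -(N : ℤ)) (fun _ => (N : ℤ))).subset ?_
  rintro v ⟨hv, -⟩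
  have key : ∀ i, v i ^ 2 ≤ (N : ℤ) := fun i => by
    rw [← hv]
    exact Finset.single_le_sum (f := fun j => v j ^ 2) (fun j _ => sq_nonneg _)
      (Finset.mem_univ i)
  refine ⟨fun i => ?_, fun i => ?_⟩
  · have := Int.le_self_sq (-(v i))
    have := key i
    simp only [neg_sq] at *
    linarith
  · have := Int.le_self_sq (v i)
    have := key i
    simp only at *
    linarith

/-- The number `p(N)` of primitive vectors of norm `N` in `ℤ³`. -/
noncomputable def primitiveCount (N : ℕ) : ℕ := (primitiveVectors N).ncard

/-- The Legendre symbol `(a/p)` for a prime `p`. -/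
def legendreSymbol (a : ℤ) (p : ℕ) (hp : p.Prime) : ℤ :=
  haveI : Fact p.Prime := ⟨hp⟩
  legendreSym p a

/-! Vectors of `ℤ³` are imaginary integral quaternions, the squared length being `normSq`. For an
odd prime `p` the heart is the recursion p(p²N) = (p - (-N/p)) p(N),
`ncard_imagPrimitive_prime_sq_mul`. It comes from counting in two ways the pairs (q, v) with q of
norm p, v primitive of norm N and q v q* not divisible by p. The map (q, v) ↦ q v q* reaches every
primitive w of norm p²N, and each fibre is an orbit of the units (`ncard_conj_fiber`).

For fixed v, the q are counted modulo p (`ncard_conj_ne_zero`). Such a q kills a line of imaginary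
quaternions spanned by an isotropic x, and q v q* ≡ 0 exactly when x ⊥ v. Each isotropic x ≠ 0 comes
from one unit orbit of q's, by a descent in the style of Lagrange's four squares theorem. So it
remains to count the points of a conic off the line v^⊥, which gives p - (-N/p).

Iterating the recursion over the primes dividing m gives the product. For even m, squares modulo 4
leave no primitive vector. -/

open scoped Quaternion

/-! ### Quaternions over a commutative ring: change of coefficients and conjugation. -/

namespace Quaternion

section CommRing

variable {R S : Type*} [CommRing R] [CommRing S]

/-- The quaternion with the given components. -/
def ofComponents (a b c d : R) : ℍ[R] := ⟨a, b, c, d⟩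

@[simp] lemma ofComponents_re (a b c d : R) : (ofComponents a b c d).re = a := rfl
@[simp] lemma ofComponents_imI (a b c d : R) : (ofComponents a b c d).imI = b := rfl
@[simp] lemma ofComponents_imJ (a b c d : R) : (ofComponents a b c d).imJ = c := rfl
@[simp] lemma ofComponents_imK (a b c d : R) : (ofComponents a b c d).imK = d := rfl

/-- The ring homomorphism between quaternion rings induced by a homomorphism of coefficients. -/
def mapRingHom (f : R →+* S) : ℍ[R] →+* ℍ[S] where
  toFun q := ofComponents (f q.re) (f q.imI) (f q.imJ) (f q.imK)
  map_one' := by ext <;> simp [Quaternion.re_one, Quaternion.imI_one, Quaternion.imJ_one,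
    Quaternion.imK_one]
  map_mul' a b := by ext <;> simp
  map_zero' := by ext <;> simp [Quaternion.re_zero, Quaternion.imI_zero, Quaternion.imJ_zero,
    Quaternion.imK_zero]
  map_add' a b := by ext <;> simp

variable (f : R →+* S) (q : ℍ[R])

@[simp] lemma mapRingHom_re : (mapRingHom f q).re = f q.re := rfl
@[simp] lemma mapRingHom_imI : (mapRingHom f q).imI = f q.imI := rfl
@[simp] lemma mapRingHom_imJ : (mapRingHom f q).imJ = f q.imJ := rfl
@[simp] lemma mapRingHom_imK : (mapRingHom f q).imK = f q.imK := rfl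

lemma mapRingHom_star : mapRingHom f (star q) = star (mapRingHom f q) := by
  ext <;> simp

lemma normSq_mapRingHom : normSq (mapRingHom f q) = f (normSq q) := by
  simp [normSq_def']

lemma mapRingHom_smul (r : R) : mapRingHom f (r • q) = f r • mapRingHom f q := by
  ext <;> simp

lemma mul_star_self_mul (a b : ℍ[R]) : a * (star a * b) = normSq a • b := by
  rw [← mul_assoc, self_mul_star, coe_mul_eq_smul]

lemma star_mul_self_mul (a b : ℍ[R]) : star a * (a * b) = normSq a • b := by
  rw [← mul_assoc, star_mul_self, coe_mul_eq_smul]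

lemma mul_mul_star_self (a b : ℍ[R]) : a * b * star b = normSq b • a := by
  rw [mul_assoc, self_mul_star, mul_coe_eq_smul]

lemma mul_star_mul_self (a b : ℍ[R]) : a * star b * b = normSq b • a := by
  rw [mul_assoc, star_mul_self, mul_coe_eq_smul]

lemma star_eq_neg_of_re_eq_zero {a : ℍ[R]} (h : a.re = 0) : star a = -a := by
  ext <;> simp [h]

lemma re_conj (a v : ℍ[R]) : (a * v * star a).re = normSq a * v.re := by
  simp [normSq_def']; ring

lemma normSq_conj (a v : ℍ[R]) : normSq (a * v * star a) = normSq a ^ 2 * normSq v := by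
  simp; ring

/-- The scalar product of the imaginary parts. -/
def imDot (x v : ℍ[R]) : R := x.imI * v.imI + x.imJ * v.imJ + x.imK * v.imK

lemma mul_add_mul_of_re_eq_zero {x v : ℍ[R]} (hx : x.re = 0) (hv : v.re = 0) :
    x * v + v * x = (-2 * imDot x v) • (1 : ℍ[R]) := by
  ext <;> simp [hx, hv, imDot, Quaternion.re_one, Quaternion.imI_one, Quaternion.imJ_one,
    Quaternion.imK_one] <;> ring

end CommRing

/-! ### Annihilators of zero divisors over a field. -/

section Field

variable {F : Type*} [Field F]

lemma normSq_eq_zero_of_mul_eq_zero {z a : ℍ[F]} (hz : z ≠ 0) (h : z * a = 0) :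
    normSq a = 0 := by
  have h1 := mul_mul_star_self z a
  rw [h, zero_mul] at h1
  exact (smul_eq_zero.mp h1.symm).resolve_right hz

/-- The norm vanishes on the whole annihilator of `z`, which is closed under addition; polarize. -/
lemma re_star_mul_eq_zero (h2 : (2 : F) ≠ 0) {z a b : ℍ[F]} (hz : z ≠ 0) (ha : z * a = 0)
    (hb : z * b = 0) : (star a * b).re = 0 := by
  have h1 := normSq_add a b
  rw [normSq_eq_zero_of_mul_eq_zero hz ha, normSq_eq_zero_of_mul_eq_zero hz hb,
    normSq_eq_zero_of_mul_eq_zero hz (show z * (a + b) = 0 by rw [mul_add, ha, hb, add_zero])] at h1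
  have h3 : 2 * (a * star b).re = 0 := by linear_combination -h1
  have h4 : (star a * b).re = (a * star b).re := by simp
  exact h4.trans ((mul_eq_zero.mp h3).resolve_left h2)

/-- The right annihilator of a nonzero quaternion is totally isotropic. -/
lemma star_mul_eq_zero (h2 : (2 : F) ≠ 0) {z a b : ℍ[F]} (hz : z ≠ 0) (ha : z * a = 0)
    (hb : z * b = 0) : star a * b = 0 := by
  -- The annihilator is a right ideal, so `b * h` lies in it too; letting `h` run through 1, i, j, k
  -- recovers every component.
  have key (h : ℍ[F]) : (star a * b * h).re = 0 := by
    rw [mul_assoc]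
    exact re_star_mul_eq_zero h2 hz ha (by rw [← mul_assoc, hb, zero_mul])
  generalize star a * b = y at key
  ext
  · simpa using key 1
  · simpa using key (ofComponents 0 1 0 0)
  · simpa using key (ofComponents 0 0 1 0)
  · simpa using key (ofComponents 0 0 0 1)

/-- The left annihilator of a nonzero quaternion is totally isotropic. -/
lemma mul_star_eq_zero (h2 : (2 : F) ≠ 0) {z a b : ℍ[F]} (hz : z ≠ 0) (ha : a * z = 0)
    (hb : b * z = 0) : a * star b = 0 := by
  have := star_mul_eq_zero h2 (z := star z) (a := star a) (b := star b) (star_ne_zero.mpr hz)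
    (by rw [← star_mul, ha, star_zero]) (by rw [← star_mul, hb, star_zero])
  simpa using this

/-- For `q` annihilating a nonzero imaginary `x`, conjugation by `q` kills precisely the imaginary
quaternions orthogonal to `x`. -/
lemma conj_eq_zero_iff (h2 : (2 : F) ≠ 0) {q x v : ℍ[F]} (hq : q ≠ 0) (hx0 : x ≠ 0)
    (hx : x.re = 0) (hv : v.re = 0) (h : q * x = 0) :
    q * v * star q = 0 ↔ imDot x v = 0 := by
  -- The anticommutator of `x` and `v` is the scalar -2 x·v; both directions compare `q * v * x`
  -- with it, using `q * x = 0`.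
  have hc := mul_add_mul_of_re_eq_zero hx hv
  constructor
  · intro h0
    have h1 : star x * (v * star q) = 0 :=
      star_mul_eq_zero h2 hq h (by rw [← mul_assoc, h0])
    have h3 : q * (v * x) = 0 := by
      have := congrArg star h1
      simpa [star_eq_neg_of_re_eq_zero hx, star_eq_neg_of_re_eq_zero hv, mul_assoc] using this
    have h4 : q * (x * v + v * x) = 0 := by
      rw [mul_add, h3, ← mul_assoc, h, zero_mul, add_zero]
    rw [hc, mul_smul_comm, mul_one] at h4
    have := (smul_eq_zero.mp h4).resolve_right hq
    exact (mul_eq_zero.mp this).resolve_left (neg_ne_zero.mpr h2)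
  · intro h0
    rw [h0, mul_zero, zero_smul] at hc
    have h1 : q * v * x = 0 := by
      rw [mul_assoc, ← neg_eq_of_add_eq_zero_right hc, mul_neg, ← mul_assoc, h, zero_mul, neg_zero]
    exact mul_star_eq_zero h2 hx0 h1 h

/-- Imaginary quaternions killed by the same nonzero `q` are proportional. -/
lemma exists_smul_eq_of_mul_eq_zero (h2 : (2 : F) ≠ 0) {q x y : ℍ[F]} (hq : q ≠ 0) (hx0 : x ≠ 0)
    (hx : x.re = 0) (hy : y.re = 0) (h : q * x = 0) (h' : q * y = 0) : ∃ c : F, c • x = y := by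
  have h1 : star x * y = 0 := star_mul_eq_zero h2 hq h h'
  have e1 := congrArg QuaternionAlgebra.imI h1
  have e2 := congrArg QuaternionAlgebra.imJ h1
  have e3 := congrArg QuaternionAlgebra.imK h1
  simp [hx, hy, Quaternion.imI_zero, Quaternion.imJ_zero, Quaternion.imK_zero] at e1 e2 e3
  have hne : x.imI ≠ 0 ∨ x.imJ ≠ 0 ∨ x.imK ≠ 0 := by
    by_contra! hc
    exact hx0 (by ext <;> simp [hx, hc.1, hc.2.1, hc.2.2, Quaternion.re_zero, Quaternion.imI_zero,
      Quaternion.imJ_zero, Quaternion.imK_zero])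
  rcases hne with hn | hn | hn
  · refine ⟨y.imI / x.imI, ?_⟩
    ext <;> simp [hx, hy] <;> field_simp <;> grind
  · refine ⟨y.imJ / x.imJ, ?_⟩
    ext <;> simp [hx, hy] <;> field_simp <;> grind
  · refine ⟨y.imK / x.imK, ?_⟩
    ext <;> simp [hx, hy] <;> field_simp <;> grind

/-- A nonzero quaternion of norm zero kills some nonzero imaginary quaternion. -/
lemma exists_re_eq_zero_mul_eq_zero (h2 : (2 : F) ≠ 0) {q : ℍ[F]} (hq : q ≠ 0)
    (hn : normSq q = 0) : ∃ x : ℍ[F], x.re = 0 ∧ x ≠ 0 ∧ q * x = 0 := by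
  by_contra! hc
  -- As `normSq q = 0`, `q` kills every `star q * y * q`. If these all vanish, the three diagonal
  -- entries of y ↦ q* y q, together with the norm, isolate 4t² for each component t of `q`.
  have key (y : ℍ[F]) (hy : y.re = 0) : star q * y * q = 0 := by
    by_contra h0
    refine hc (star q * y * q) ?_ h0 ?_
    · have := re_conj (star q) y
      rw [star_star] at this
      rw [this, hy, mul_zero]
    · rw [mul_assoc, mul_star_self_mul, hn, zero_smul]
  have k1 := congrArg QuaternionAlgebra.imI (key (ofComponents 0 1 0 0) rfl)
  have k2 := congrArg QuaternionAlgebra.imJ (key (ofComponents 0 0 1 0) rfl)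
  have k3 := congrArg QuaternionAlgebra.imK (key (ofComponents 0 0 0 1) rfl)
  rw [normSq_def'] at hn
  simp [Quaternion.imI_zero, Quaternion.imJ_zero, Quaternion.imK_zero] at k1 k2 k3
  have h4 (t : F) (ht : 2 * (2 * t ^ 2) = 0) : t = 0 := by simpa [h2] using ht
  apply hq
  ext
  · exact h4 _ (by linear_combination hn + k1 + k2 + k3)
  · exact h4 _ (by linear_combination hn + k1 - k2 - k3)
  · exact h4 _ (by linear_combination hn - k1 + k2 - k3)
  · exact h4 _ (by linear_combination hn - k1 - k2 + k3)

end Field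

end Quaternion

/-! ### Integral quaternions of norm `p`: reduction and descent. -/

namespace Quaternion

/-- Reduction of integral quaternions modulo `p`. -/
def red (p : ℕ) : ℍ[ℤ] →+* ℍ[ZMod p] := mapRingHom (Int.castRingHom (ZMod p))

lemma red_star (p : ℕ) (q : ℍ[ℤ]) : red p (star q) = star (red p q) := mapRingHom_star _ _

lemma normSq_red (p : ℕ) (q : ℍ[ℤ]) : normSq (red p q) = ((normSq q : ℤ) : ZMod p) :=
  normSq_mapRingHom _ _

lemma red_smul (p : ℕ) (r : ℤ) (q : ℍ[ℤ]) : red p (r • q) = (r : ZMod p) • red p q :=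
  mapRingHom_smul _ _ _

lemma red_eq_zero_iff (p : ℕ) (q : ℍ[ℤ]) : red p q = 0 ↔ ∃ c, q = (p : ℤ) • c := by
  constructor
  · intro h
    have h1 : (p : ℤ) ∣ q.re := (ZMod.intCast_zmod_eq_zero_iff_dvd _ _).mp
      (congrArg QuaternionAlgebra.re h)
    have h2 : (p : ℤ) ∣ q.imI := (ZMod.intCast_zmod_eq_zero_iff_dvd _ _).mp
      (congrArg QuaternionAlgebra.imI h)
    have h3 : (p : ℤ) ∣ q.imJ := (ZMod.intCast_zmod_eq_zero_iff_dvd _ _).mp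
      (congrArg QuaternionAlgebra.imJ h)
    have h4 : (p : ℤ) ∣ q.imK := (ZMod.intCast_zmod_eq_zero_iff_dvd _ _).mp
      (congrArg QuaternionAlgebra.imK h)
    obtain ⟨a, ha⟩ := h1
    obtain ⟨b, hb⟩ := h2
    obtain ⟨c, hc⟩ := h3
    obtain ⟨d, hd⟩ := h4
    exact ⟨ofComponents a b c d, by ext <;> simp [ha, hb, hc, hd]⟩
  · rintro ⟨c, rfl⟩
    rw [red_smul]
    simp

lemma normSq_ofComponents {R : Type*} [CommRing R] (a b c d : R) :
    normSq (ofComponents a b c d) = a ^ 2 + b ^ 2 + c ^ 2 + d ^ 2 := by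
  simp [normSq_def']

/-- The components have even sum, so the real part shares its parity with some imaginary one, and
the remaining two then agree as well. Multiply by 1+i, 1+j or 1+k accordingly. -/
lemma exists_mul_eq_two_smul (q : ℍ[ℤ]) (h : Even (normSq q)) :
    ∃ g q' : ℍ[ℤ], normSq g = 2 ∧ g * q = (2 : ℤ) • q' := by
  rw [normSq_def'] at h
  have h' : (q.re + q.imI + q.imJ + q.imK) % 2 = 0 := by
    have := Int.even_iff.mp h
    have e (t : ℤ) : t ^ 2 % 2 = t % 2 := by
      rcases Int.emod_two_eq_zero_or_one t with h | h <;> simp [pow_two, Int.mul_emod, h]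
    have := e q.re
    have := e q.imI
    have := e q.imJ
    have := e q.imK
    omega
  have hc : (q.re - q.imI) % 2 = 0 ∨ (q.re - q.imJ) % 2 = 0 ∨ (q.re - q.imK) % 2 = 0 := by omega
  rcases hc with hc | hc | hc
  · refine ⟨ofComponents 1 1 0 0, ofComponents ((q.re - q.imI) / 2) ((q.re + q.imI) / 2)
      ((q.imJ - q.imK) / 2) ((q.imJ + q.imK) / 2), by simp [normSq_ofComponents], ?_⟩
    rw [two_smul]
    ext <;> simp <;> omega
  · refine ⟨ofComponents 1 0 1 0, ofComponents ((q.re - q.imJ) / 2) ((q.imI + q.imK) / 2)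
      ((q.re + q.imJ) / 2) ((q.imK - q.imI) / 2), by simp [normSq_ofComponents], ?_⟩
    rw [two_smul]
    ext <;> simp <;> omega
  · refine ⟨ofComponents 1 0 0 1, ofComponents ((q.re - q.imK) / 2) ((q.imI - q.imJ) / 2)
      ((q.imI + q.imJ) / 2) ((q.re + q.imK) / 2), by simp [normSq_ofComponents], ?_⟩
    rw [two_smul]
    ext <;> simp <;> omega

lemma exists_small_residue {m : ℕ} (hm : Odd m) (a : ℤ) :
    ∃ r s : ℤ, a = r + m * s ∧ 4 * r ^ 2 < (m : ℤ) ^ 2 := by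
  obtain ⟨k, rfl⟩ := hm
  refine ⟨Int.bmod a (2 * k + 1), Int.bdiv a (2 * k + 1), ?_, ?_⟩
  · exact (Int.bmod_add_bdiv a _).symm
  · have h1 := Int.le_bmod (x := a) (m := 2 * k + 1) (by omega)
    have h2 := Int.bmod_lt (x := a) (m := 2 * k + 1) (by omega)
    generalize Int.bmod a (2 * k + 1) = r at *
    push_cast at *
    have h3 : -(k : ℤ) ≤ r := by omega
    have h4 : r ≤ (k : ℤ) := by omega
    nlinarith

/-- Balanced remainders of the four components each have square below m²/4; the inequality is strict
because `m` is odd. -/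
lemma exists_small_remainder {m : ℕ} (hm : Odd m) (q : ℍ[ℤ]) :
    ∃ r s : ℍ[ℤ], q = r + (m : ℤ) • s ∧ normSq r < (m : ℤ) ^ 2 := by
  obtain ⟨a, a', ha, ha'⟩ := exists_small_residue hm q.re
  obtain ⟨b, b', hb, hb'⟩ := exists_small_residue hm q.imI
  obtain ⟨c, c', hc, hc'⟩ := exists_small_residue hm q.imJ
  obtain ⟨d, d', hd, hd'⟩ := exists_small_residue hm q.imK
  refine ⟨ofComponents a b c d, ofComponents a' b' c' d', ?_, ?_⟩
  · ext <;> simpa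
  · rw [normSq_ofComponents]
    linarith

variable {p : ℕ} [Fact p.Prime]

lemma two_ne_zero_zmod (hp2 : p ≠ 2) : (2 : ZMod p) ≠ 0 := by
  have hp : p.Prime := Fact.out
  have : ((2 : ℕ) : ZMod p) ≠ 0 := by
    rw [Ne, ZMod.natCast_eq_zero_iff]
    exact fun h => hp2 ((Nat.prime_dvd_prime_iff_eq hp Nat.prime_two).mp h)
  exact_mod_cast this

/-- Descent on `m`, using only left multiplication and division by integers prime to `p`, so that
`x` stays killed. For even `m` a factor of norm 2 halves it. For odd `m`, with `r` the small
remainder of `q` modulo `m` and `normSq r = m * t`, the quaternion `star r * q` divided by `m` has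
norm `t * p` with `t < m`. -/
lemma exists_normSq_eq_prime_of_lt (x : ℍ[ZMod p]) (hp2 : p ≠ 2) (m : ℕ) (h0 : 0 < m) (hm : m < p)
    (q : ℍ[ℤ]) (hq : normSq q = m * p) (hqx : red p q * x = 0) :
    ∃ q : ℍ[ℤ], normSq q = p ∧ red p q * x = 0 := by
  have hp : p.Prime := Fact.out
  induction m using Nat.strong_induction_on generalizing q with
  | _ m ih =>
  rcases Nat.even_or_odd m with he | ho
  · obtain ⟨g, q', hg, hgq⟩ := exists_mul_eq_two_smul q (by
      rw [hq]; exact_mod_cast he.mul_right p)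
    obtain ⟨k, rfl⟩ := he
    refine ih k (by omega) (by omega) (by omega) q' ?_ ?_
    · have := congrArg normSq hgq
      rw [map_mul, normSq_smul, hg, hq] at this
      push_cast at this
      linarith
    · have := congrArg (fun y => red p y * x) hgq
      simp only [map_mul, red_smul, mul_assoc, hqx, mul_zero, smul_mul_assoc] at this
      refine (smul_eq_zero.mp this.symm).resolve_left ?_
      exact_mod_cast two_ne_zero_zmod hp2
  · by_cases h1 : m = 1
    · exact ⟨q, by simpa [h1] using hq, hqx⟩
    have hm0 : (m : ℤ) ≠ 0 := by exact_mod_cast h0.ne'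
    obtain ⟨r, s, hrs, hr⟩ := exists_small_remainder ho q
    have hdvd : (m : ℤ) ∣ normSq r := by
      have e : normSq q = normSq r + m * (m * normSq s + 2 * (r * star s).re) := by
        rw [hrs, normSq_add, normSq_smul, star_smul, mul_smul_comm, re_smul]
        simp only [smul_eq_mul]
        ring
      rw [hq] at e
      exact ⟨p - (m * normSq s + 2 * (r * star s).re), by linear_combination -e⟩
    obtain ⟨t, ht⟩ := hdvd
    have hr0 : 0 ≤ normSq r := normSq_nonneg
    have hmpos : (0 : ℤ) < m := by exact_mod_cast h0
    have ht0 : 0 ≤ t := by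
      by_contra! hc
      nlinarith
    have htm : t < m := by
      rw [ht, pow_two] at hr
      exact lt_of_mul_lt_mul_left hr hmpos.le
    lift t to ℕ using ht0
    have hmul : star r * q = (m : ℤ) • (((t : ℤ) : ℍ[ℤ]) + star r * s) := by
      rw [hrs, mul_add, star_mul_self, ht, mul_smul_comm, smul_add]
      congr 1
    have hq' : normSq (((t : ℤ) : ℍ[ℤ]) + star r * s) = t * p := by
      have := congrArg normSq hmul
      rw [map_mul, normSq_smul, hq, normSq_star, ht] at this
      refine mul_left_cancel₀ (pow_ne_zero 2 hm0) ?_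
      linear_combination -this
    refine ih t (by exact_mod_cast htm) ?_ (by omega) _ hq' ?_
    · rw [Nat.pos_iff_ne_zero]
      -- If t = 0 then `m` divides `q`, hence m² divides mp, against 1 < m < p.
      rintro rfl
      have hr : r = 0 := by
        rw [← normSq_eq_zero, ht]; simp
      rw [hr, zero_add] at hrs
      rw [hrs, normSq_smul] at hq
      have h2 : (m : ℤ) * normSq s = p := mul_left_cancel₀ hm0 (by linear_combination hq)
      have h3 : m ∣ p := by exact_mod_cast Dvd.intro _ h2
      rcases (Nat.dvd_prime hp).mp h3 with h | h <;> omega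
    · have := congrArg (fun y => red p y * x) hmul
      simp only [map_mul, red_smul, mul_assoc, hqx, mul_zero, smul_mul_assoc] at this
      refine (smul_eq_zero.mp this.symm).resolve_left ?_
      rw [Int.cast_natCast, ZMod.natCast_eq_zero_iff]
      exact fun h => absurd (Nat.le_of_dvd h0 h) (by omega)

/-- An imaginary `x` of norm zero has x² = 0, so it kills itself. A lift with balanced components
has norm below p² and divisible by `p`: the descent starts there. -/
lemma exists_normSq_eq_prime (hp2 : p ≠ 2) {x : ℍ[ZMod p]} (hx0 : x ≠ 0) (hx : x.re = 0)
    (hn : normSq x = 0) : ∃ q : ℍ[ℤ], normSq q = p ∧ red p q * x = 0 := by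
  have hp : p.Prime := Fact.out
  have hp0 : (0 : ℤ) < p := by exact_mod_cast hp.pos
  have hodd := hp.odd_of_ne_two hp2
  obtain ⟨b, b', hb, hb'⟩ := exists_small_residue hodd x.imI.valMinAbs
  obtain ⟨c, c', hc, hc'⟩ := exists_small_residue hodd x.imJ.valMinAbs
  obtain ⟨d, d', hd, hd'⟩ := exists_small_residue hodd x.imK.valMinAbs
  have hred : red p (ofComponents 0 b c d) = x := by
    have e (y : ZMod p) (r s : ℤ) (h : y.valMinAbs = r + p * s) : (r : ZMod p) = y := by
      have := congrArg (Int.cast : ℤ → ZMod p) h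
      simpa using this.symm
    ext
    · simp [red, hx]
    · simpa [red] using e _ _ _ hb
    · simpa [red] using e _ _ _ hc
    · simpa [red] using e _ _ _ hd
  have hN : (p : ℤ) ∣ normSq (ofComponents 0 b c d) := by
    rw [← ZMod.intCast_zmod_eq_zero_iff_dvd, ← normSq_red, hred, hn]
  have hpos : 0 < normSq (ofComponents 0 b c d) := by
    refine lt_of_le_of_ne normSq_nonneg (Ne.symm ?_)
    rw [Ne, normSq_eq_zero]
    intro h
    rw [h, map_zero] at hred
    exact hx0 hred.symm
  have hlt : normSq (ofComponents 0 b c d) < (p : ℤ) ^ 2 := by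
    rw [normSq_ofComponents]
    nlinarith
  obtain ⟨t, ht⟩ := hN
  rw [ht] at hpos hlt
  have ht0 : 0 < t := pos_of_mul_pos_right hpos hp0.le
  have htp : t < p := lt_of_mul_lt_mul_left (by rwa [pow_two] at hlt) hp0.le
  lift t to ℕ using ht0.le
  refine exists_normSq_eq_prime_of_lt x hp2 t (by exact_mod_cast ht0) (by exact_mod_cast htp)
    (ofComponents 0 b c d) (by rw [ht, mul_comm]) ?_
  rw [hred]
  have h1 := self_mul_star x
  rw [hn, star_eq_neg_of_re_eq_zero hx, mul_neg, neg_eq_iff_eq_neg] at h1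
  rw [h1]
  simp

/-- Integral quaternions of norm `p` killing a given `x` mod `p` form a single orbit of units. -/
lemma ncard_mul_eq_zero (hp2 : p ≠ 2) {x : ℍ[ZMod p]} (hx0 : x ≠ 0) (hx : x.re = 0)
    (hn : normSq x = 0) :
    {q : ℍ[ℤ] | normSq q = p ∧ red p q * x = 0}.ncard = {u : ℍ[ℤ] | normSq u = 1}.ncard := by
  have hp : p.Prime := Fact.out
  have hp0 : (p : ℤ) ≠ 0 := by exact_mod_cast hp.ne_zero
  obtain ⟨q₀, hq₀, hq₀x⟩ := exists_normSq_eq_prime hp2 hx0 hx hn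
  have hq₀0 : q₀ ≠ 0 := by
    rintro rfl
    rw [map_zero] at hq₀
    exact hp0 hq₀.symm
  have : {q : ℍ[ℤ] | normSq q = p ∧ red p q * x = 0} =
      (fun u => u * q₀) '' {u : ℍ[ℤ] | normSq u = 1} := by
    ext q
    constructor
    · rintro ⟨h1, h2⟩
      -- Both `q` and `q₀` kill `x` from the left, so `q * star q₀` is divisible by `p`; the
      -- quotient is the required unit.
      have h3 := mul_star_eq_zero (two_ne_zero_zmod hp2) hx0 h2 hq₀x
      rw [← red_star, ← map_mul, red_eq_zero_iff] at h3
      obtain ⟨u, hu⟩ := h3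
      refine ⟨u, ?_, ?_⟩
      · have := congrArg normSq hu
        rw [map_mul, normSq_star, normSq_smul, h1, hq₀] at this
        exact mul_left_cancel₀ (pow_ne_zero 2 hp0) (by linear_combination -this)
      · have := congrArg (· * q₀) hu
        simp only [mul_star_mul_self, hq₀, smul_mul_assoc] at this
        exact (smul_right_injective _ hp0 this).symm
    · rintro ⟨u, hu, rfl⟩
      refine ⟨?_, ?_⟩
      · rw [map_mul, hq₀, hu, one_mul]
      · rw [map_mul, mul_assoc, hq₀x, mul_zero]
  rw [this, Set.ncard_image_of_injective _ (mul_left_injective₀ hq₀0)]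

lemma ncard_mul_eq_zero' (hp2 : p ≠ 2) {x : ℍ[ZMod p]} (hx0 : x ≠ 0) (hx : x.re = 0)
    (hn : normSq x = 0) :
    {q : ℍ[ℤ] | normSq q = p ∧ x * red p q = 0}.ncard = {u : ℍ[ℤ] | normSq u = 1}.ncard := by
  rw [← ncard_mul_eq_zero hp2 hx0 hx hn, ← Set.ncard_image_of_injective _ star_injective]
  congr 1
  ext q
  rw [star_involutive.image_eq_preimage_symm, Set.mem_preimage, Set.mem_ofPred_eq,
    Set.mem_ofPred_eq, normSq_star, red_star, ← star_eq_zero (x := x * _), star_mul, star_star,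
    star_eq_neg_of_re_eq_zero hx, mul_neg, neg_eq_zero]

end Quaternion

/-! ### Points of a quadratic cone over a finite field. -/

section QuadraticPolynomial

variable {F : Type*} [Field F] [Fintype F] [DecidableEq F]

lemma ncard_quadratic_eq_zero (hF : ringChar F ≠ 2) {a : F} (ha : a ≠ 0) (b c : F) :
    ({t : F | a * t ^ 2 + b * t + c = 0}.ncard : ℤ) =
      quadraticChar F (b ^ 2 - 4 * a * c) + 1 := by
  have h2 : (2 : F) ≠ 0 := Ring.two_ne_zero hF
  rw [← quadraticChar_card_sqrts hF, ← Set.ncard_eq_toFinset_card']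
  have hinj : Function.Injective (fun t : F => 2 * a * t + b) := fun s t h =>
    mul_left_cancel₀ (mul_ne_zero h2 ha) (add_right_cancel h)
  rw [← Set.ncard_image_of_injective _ hinj]
  congr 2
  ext s
  constructor
  · rintro ⟨t, ht, rfl⟩
    have ht : a * t ^ 2 + b * t + c = 0 := ht
    change (2 * a * t + b) ^ 2 = _
    linear_combination 4 * a * ht
  · intro hs
    have hs : s ^ 2 = b ^ 2 - 4 * a * c := hs
    refine ⟨(s - b) / (2 * a), ?_, ?_⟩
    · change a * ((s - b) / (2 * a)) ^ 2 + b * ((s - b) / (2 * a)) + c = 0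
      field_simp
      linear_combination hs
    · field_simp
      ring

/-- The `if` accounts for the point at infinity: on the projective line a nonzero binary form has 1
+ χ(disc) zeros among |F| + 1 points, and infinity is not a zero exactly when `a ≠ 0`. -/
lemma ncard_quadratic_ne_zero (hF : ringChar F ≠ 2) (a b c : F) (h : a ≠ 0 ∨ b ≠ 0 ∨ c ≠ 0) :
    ({t : F | a * t ^ 2 + b * t + c ≠ 0}.ncard : ℤ) + (if a = 0 then 0 else 1) =
      Fintype.card F - quadraticChar F (b ^ 2 - 4 * a * c) := by
  have hc : ({t : F | a * t ^ 2 + b * t + c = 0}.ncard : ℤ) +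
      {t : F | a * t ^ 2 + b * t + c ≠ 0}.ncard = Fintype.card F := by
    have h := Set.ncard_add_ncard_compl {t : F | a * t ^ 2 + b * t + c = 0}
    rw [Nat.card_eq_fintype_card] at h
    rw [← h, Nat.cast_add]
    rfl
  by_cases ha : a = 0
  · subst ha
    by_cases hb : b = 0
    · subst hb
      have : {t : F | 0 * t ^ 2 + 0 * t + c = 0} = ∅ := by
        ext t
        simpa using h
      rw [this] at hc
      simp at hc ⊢
      simpa using hc
    · have : {t : F | 0 * t ^ 2 + b * t + c = 0} = {-c / b} := by
        ext t
        simp only [Set.mem_ofPred_eq, Set.mem_singleton_iff]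
        constructor
        · intro h
          field_simp
          linear_combination h
        · rintro rfl
          field_simp
          ring
      rw [this, Set.ncard_singleton] at hc
      have h1 : b ^ 2 - 4 * 0 * c = b ^ 2 := by ring
      rw [h1, quadraticChar_sq_one' hb, if_pos rfl]
      push_cast at hc
      linarith
  · rw [ncard_quadratic_eq_zero hF ha] at hc
    rw [if_neg ha]
    linarith

/-- The number of points of the cone `XY = Z²` off a given plane. -/
lemma ncard_cone_ne_zero (hF : ringChar F ≠ 2) (a b c : F) (h : a ≠ 0 ∨ b ≠ 0 ∨ c ≠ 0) :
    ({x : F × F × F | x.1 * x.2.1 = x.2.2 ^ 2 ∧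
        a * x.1 + c * x.2.1 + b * x.2.2 ≠ 0}.ncard : ℤ) =
      (Fintype.card F - 1) * (Fintype.card F - quadraticChar F (b ^ 2 - 4 * a * c)) := by
  have hunits : (({0}ᶜ : Set F).ncard : ℤ) = Fintype.card F - 1 := by
    have := Set.ncard_add_ncard_compl ({0} : Set F)
    rw [Set.ncard_singleton, Nat.card_eq_fintype_card] at this
    omega
  -- Points with Y ≠ 0 are given by Y and t = Z/Y; on Y = 0 the cone reduces to the line Z = 0,
  -- which is `B`.
  set A : Set (F × F × F) := (fun y : F × F => (y.1 * y.2 ^ 2, y.1, y.1 * y.2)) ''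
    (({0}ᶜ : Set F) ×ˢ {t : F | a * t ^ 2 + b * t + c ≠ 0})
  set B : Set (F × F × F) := (fun y : F => (y, 0, 0)) '' {y : F | a * y ≠ 0}
  have hAB : {x : F × F × F | x.1 * x.2.1 = x.2.2 ^ 2 ∧
      a * x.1 + c * x.2.1 + b * x.2.2 ≠ 0} = A ∪ B := by
    ext ⟨X, Y, Z⟩
    simp only [A, B, Set.mem_ofPred_eq, Set.mem_union, Set.mem_image, Set.mem_prod, Prod.exists,
      Prod.mk.injEq, Set.mem_compl_iff, Set.mem_singleton_iff]
    constructor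
    · rintro ⟨h1, h2⟩
      by_cases hY : Y = 0
      · subst hY
        have hZ : Z = 0 := by simpa using h1.symm
        subst hZ
        exact .inr ⟨X, by simpa using h2, rfl, rfl, rfl⟩
      · refine .inl ⟨Y, Z / Y, ⟨hY, fun h0 => h2 ?_⟩, ?_, rfl, ?_⟩
        · field_simp at h0
          have : Y * (a * X + c * Y + b * Z) = 0 := by linear_combination h0 + a * h1
          exact (mul_eq_zero.mp this).resolve_left hY
        · field_simp
          rw [← h1, mul_comm]
        · field_simp
    · rintro (⟨Y, t, ⟨hY, ht⟩, rfl, rfl, rfl⟩ | ⟨X, hX, rfl, rfl, rfl⟩)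
      · refine ⟨by ring, ?_⟩
        have : a * (Y * t ^ 2) + c * Y + b * (Y * t) = Y * (a * t ^ 2 + b * t + c) := by ring
        rw [this]
        exact mul_ne_zero hY ht
      · simpa using hX
  have hdisj : Disjoint A B := by
    rw [Set.disjoint_left]
    rintro _ ⟨⟨y, t⟩, ⟨hy, -⟩, rfl⟩ ⟨x, -, hx⟩
    simp only [Prod.mk.injEq] at hx
    exact hy hx.2.1.symm
  have hA : (A.ncard : ℤ) =
      (Fintype.card F - 1) * {t : F | a * t ^ 2 + b * t + c ≠ 0}.ncard := by
    rw [Set.InjOn.ncard_image, Set.ncard_prod]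
    · push_cast
      rw [hunits]
    · rintro ⟨y, t⟩ ⟨hy, -⟩ ⟨y', t'⟩ - h
      simp only [Prod.mk.injEq] at h ⊢
      obtain ⟨-, rfl, h3⟩ := h
      exact ⟨rfl, mul_left_cancel₀ hy h3⟩
  have hB : (B.ncard : ℤ) = (Fintype.card F - 1) * (if a = 0 then 0 else 1) := by
    rw [Set.ncard_image_of_injective _ fun x y h => by simpa using h]
    split_ifs with ha
    · simp [ha]
    · rw [mul_one, ← hunits]
      congr 2
      ext y
      simp [ha]
  rw [hAB, Set.ncard_union_eq hdisj, ← ncard_quadratic_ne_zero hF a b c h]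
  push_cast
  rw [hA, hB]
  ring

end QuadraticPolynomial

/-! ### Isotropic vectors modulo `p`. -/

namespace Quaternion

variable {p : ℕ} [Fact p.Prime]

lemma finite_quaternion : Finite ℍ[ZMod p] :=
  Finite.of_equiv _ (equivTuple (ZMod p)).symm

/-- The number of isotropic vectors modulo `p` not orthogonal to a given nonzero vector. -/
lemma ncard_isotropic_imDot_ne_zero (hp2 : p ≠ 2) {v : ℍ[ZMod p]} (hv0 : v ≠ 0) (hv : v.re = 0) :
    ({x : ℍ[ZMod p] | x.re = 0 ∧ normSq x = 0 ∧ imDot x v ≠ 0}.ncard : ℤ) =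
      (p - 1) * (p - quadraticChar (ZMod p) (-normSq v)) := by
  have hF : ringChar (ZMod p) ≠ 2 := by rwa [ZMod.ringChar_zmod_n]
  have h2 := two_ne_zero_zmod hp2
  -- A solution of a² + b² = -1 makes the ternary form isotropic. The map `φ` below carries XY = Z²
  -- onto the isotropic cone; `P` and `Q` express `imDot · v` in these coordinates, with
  -- discriminant -4 `normSq v`.
  obtain ⟨a, b, hab⟩ := ZMod.sq_add_sq p (-1)
  set P := -(a * v.imI + b * v.imJ) with hP
  set Q := b * v.imI - a * v.imJ with hQ
  have hne : v.imK - P ≠ 0 ∨ 2 * Q ≠ 0 ∨ v.imK + P ≠ 0 := by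
    by_contra! hc
    obtain ⟨h1, h3, h4⟩ := hc
    have h5 : Q = 0 := (mul_eq_zero.mp h3).resolve_left h2
    have h6 : P = 0 := (mul_eq_zero.mp (show 2 * P = 0 by linear_combination h4 - h1)).resolve_left h2
    apply hv0
    ext
    · exact hv
    · change v.imI = 0
      linear_combination v.imI * hab + b * hQ - b * h5 - a * hP + a * h6
    · change v.imJ = 0
      linear_combination v.imJ * hab - a * hQ + a * h5 - b * hP + b * h6
    · change v.imK = 0
      linear_combination h1 + h6
  have hcard := ncard_cone_ne_zero hF _ _ _ hne
  have hdisc : (2 * Q) ^ 2 - 4 * (v.imK - P) * (v.imK + P) = 2 ^ 2 * -normSq v := by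
    rw [normSq_def', hP, hQ, hv]
    linear_combination 4 * (v.imI ^ 2 + v.imJ ^ 2) * hab
  rw [hdisc, map_mul, quadraticChar_sq_one' h2, one_mul, ZMod.card] at hcard
  rw [← hcard]
  let φ : ZMod p × ZMod p × ZMod p → ℍ[ZMod p] := fun y =>
    ofComponents 0 (-(a * (y.2.1 - y.1) - 2 * b * y.2.2)) (-(b * (y.2.1 - y.1) + 2 * a * y.2.2))
      (y.1 + y.2.1)
  have hnorm (y : ZMod p × ZMod p × ZMod p) :
      normSq (φ y) = 2 ^ 2 * (y.1 * y.2.1 - y.2.2 ^ 2) := by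
    simp only [φ, normSq_ofComponents]
    linear_combination ((y.2.1 - y.1) ^ 2 + 4 * y.2.2 ^ 2) * hab
  have hdot (y : ZMod p × ZMod p × ZMod p) :
      imDot (φ y) v = (v.imK - P) * y.1 + (v.imK + P) * y.2.1 + 2 * Q * y.2.2 := by
    simp only [φ, imDot, ofComponents_imI, ofComponents_imJ, ofComponents_imK, hP, hQ]
    ring
  have hinj : Function.Injective φ := by
    rintro ⟨X, Y, Z⟩ ⟨X', Y', Z'⟩ h
    have e1 := congrArg QuaternionAlgebra.imI h
    have e2 := congrArg QuaternionAlgebra.imJ h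
    have e3 := congrArg QuaternionAlgebra.imK h
    simp only [φ, ofComponents_imI, ofComponents_imJ, ofComponents_imK] at e1 e2 e3
    have e4 : Y - X = Y' - X' := by
      linear_combination a * e1 + b * e2 + (Y - X - Y' + X') * hab
    have e5 : Z = Z' := mul_left_cancel₀ h2 (by
      linear_combination -b * e1 + a * e2 + 2 * (Z - Z') * hab)
    have e6 : X = X' := mul_left_cancel₀ h2 (by linear_combination e3 - e4)
    have e7 : Y = Y' := by linear_combination e4 + e6
    rw [e5, e6, e7]
  rw [← Set.ncard_image_of_injective _ hinj]
  congr 2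
  ext x
  constructor
  · rintro ⟨h1, h3, h4⟩
    let y : ZMod p × ZMod p × ZMod p := ((x.imK - (a * x.imI + b * x.imJ)) / 2,
      (x.imK + (a * x.imI + b * x.imJ)) / 2, (-(b * x.imI) + a * x.imJ) / 2)
    have hy : φ y = x := by
      ext
      · exact h1.symm
      · simp only [φ, y, ofComponents_imI]
        field_simp
        linear_combination -2 * x.imI * hab
      · simp only [φ, y, ofComponents_imJ]
        field_simp
        linear_combination -2 * x.imJ * hab
      · simp only [φ, y, ofComponents_imK]
        field_simp
        ring
    refine ⟨y, ⟨?_, ?_⟩, hy⟩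
    · rw [← hy, hnorm] at h3
      exact sub_eq_zero.mp ((mul_eq_zero.mp h3).resolve_left (pow_ne_zero 2 h2))
    · rwa [← hdot, hy]
  · rintro ⟨y, ⟨h1, h3⟩, rfl⟩
    refine ⟨rfl, ?_, ?_⟩
    · rw [hnorm, h1, sub_self, mul_zero]
    · rwa [hdot]

/-- The imaginary quaternions killed by a nonzero quaternion of norm zero form a line. -/
lemma ncard_ker_ne_zero (hp2 : p ≠ 2) {q : ℍ[ZMod p]} (hq : q ≠ 0) (hn : normSq q = 0) :
    {x : ℍ[ZMod p] | x.re = 0 ∧ x ≠ 0 ∧ q * x = 0}.ncard = p - 1 := by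
  have h2 := two_ne_zero_zmod hp2
  obtain ⟨x₀, hx₀, hx₀0, hqx₀⟩ := exists_re_eq_zero_mul_eq_zero h2 hq hn
  have : {x : ℍ[ZMod p] | x.re = 0 ∧ x ≠ 0 ∧ q * x = 0} =
      (fun c : ZMod p => c • x₀) '' {0}ᶜ := by
    ext x
    constructor
    · rintro ⟨h1, h3, h4⟩
      obtain ⟨c, rfl⟩ := exists_smul_eq_of_mul_eq_zero h2 hq hx₀0 hx₀ h1 hqx₀ h4
      refine ⟨c, ?_, rfl⟩
      rintro rfl
      exact h3 (zero_smul _ _)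
    · rintro ⟨c, hc, rfl⟩
      refine ⟨?_, smul_ne_zero hc hx₀0, ?_⟩
      · simp [hx₀]
      · rw [mul_smul_comm, hqx₀, smul_zero]
  rw [this, Set.ncard_image_of_injective _ (smul_left_injective _ hx₀0)]
  have := Set.ncard_add_ncard_compl ({0} : Set (ZMod p))
  rw [Set.ncard_singleton, Nat.card_eq_fintype_card, ZMod.card] at this
  omega

end Quaternion

/-- Double counting for a relation all of whose fibres have constant cardinality. -/
lemma Set.ncard_mul_eq_ncard_mul {α β : Type*} {s : Set α} {t : Set β} (hs : s.Finite)
    (ht : t.Finite) (r : α → β → Prop) {m n : ℤ}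
    (hm : ∀ a ∈ s, ({b | b ∈ t ∧ r a b}.ncard : ℤ) = m)
    (hn : ∀ b ∈ t, ({a | a ∈ s ∧ r a b}.ncard : ℤ) = n) :
    (s.ncard : ℤ) * m = t.ncard * n := by
  classical
  lift s to Finset α using hs
  lift t to Finset β using ht
  have h := Finset.sum_card_bipartiteAbove_eq_sum_card_bipartiteBelow (s := s) (t := t) r
  have h1 : ∀ a ∈ s, ((t.bipartiteAbove r a).card : ℤ) = m := fun a ha => by
    rw [← hm a (by simpa using ha), ← Set.ncard_coe_finset, Finset.coe_bipartiteAbove]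
    rfl
  have h2 : ∀ b ∈ t, ((s.bipartiteBelow r b).card : ℤ) = n := fun b hb => by
    rw [← hn b (by simpa using hb), ← Set.ncard_coe_finset, Finset.coe_bipartiteBelow]
    rfl
  have h' := congrArg (Nat.cast : ℕ → ℤ) h
  rw [Nat.cast_sum, Nat.cast_sum, Finset.sum_congr rfl h1, Finset.sum_congr rfl h2,
    Finset.sum_const, Finset.sum_const, nsmul_eq_mul, nsmul_eq_mul] at h'
  rwa [Set.ncard_coe_finset, Set.ncard_coe_finset]

/-! ### The recursion from N to p²N. -/

namespace Quaternion

/-- The primitive imaginary integral quaternions of norm `N`. -/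
def imagPrimitive (N : ℕ) : Set ℍ[ℤ] :=
  {v | v.re = 0 ∧ normSq v = N ∧ ∀ r : ℕ, r.Prime → red r v ≠ 0}

lemma finite_normSq_eq (N : ℤ) : {q : ℍ[ℤ] | normSq q = N}.Finite := by
  have hI := Set.finite_Icc (-N) N
  refine ((hI.prod (hI.prod (hI.prod hI))).image
    fun x => ofComponents x.1 x.2.1 x.2.2.1 x.2.2.2).subset fun q hq => ?_
  have hq : normSq q = N := hq
  rw [normSq_def'] at hq
  have key (t : ℤ) (ht : t ^ 2 ≤ N) : t ∈ Set.Icc (-N) N := by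
    constructor <;> nlinarith [Int.le_self_sq t, Int.le_self_sq (-t)]
  refine ⟨(q.re, q.imI, q.imJ, q.imK), ⟨key _ ?_, key _ ?_, key _ ?_, key _ ?_⟩, ?_⟩
  iterate 4 nlinarith [sq_nonneg q.re, sq_nonneg q.imI, sq_nonneg q.imJ, sq_nonneg q.imK]
  ext <;> simp

lemma finite_imagPrimitive (N : ℕ) : (imagPrimitive N).Finite :=
  (finite_normSq_eq N).subset fun _ h => h.2.1

variable {p : ℕ} [Fact p.Prime]

lemma red_ne_zero_of_normSq_eq {q : ℍ[ℤ]} (hq : normSq q = p) : red p q ≠ 0 := by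
  have hp : p.Prime := Fact.out
  rw [Ne, red_eq_zero_iff]
  rintro ⟨c, rfl⟩
  rw [normSq_smul] at hq
  have h1 : (p : ℤ) * normSq c = 1 :=
    mul_left_cancel₀ (a := (p : ℤ)) (by exact_mod_cast hp.ne_zero) (by linear_combination hq)
  have h2 : (p : ℤ) ∣ 1 := Dvd.intro _ h1
  exact hp.one_lt.ne' (by exact_mod_cast Int.eq_one_of_dvd_one (by positivity) h2)

lemma normSq_red_eq_zero {q : ℍ[ℤ]} (hq : normSq q = p) : normSq (red p q) = 0 := by
  rw [normSq_red, hq]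
  simp

lemma ncard_units_ne_zero : ({u : ℍ[ℤ] | normSq u = 1}.ncard : ℤ) ≠ 0 := by
  rw [Nat.cast_ne_zero]
  exact Set.ncard_ne_zero_of_mem (a := 1) (map_one normSq) (finite_normSq_eq 1)

/-- The number of `q` of norm `p` whose conjugation action does not kill `v` modulo `p`. -/
lemma ncard_conj_ne_zero (hp2 : p ≠ 2) {N : ℕ} {v : ℍ[ℤ]} (hv : v ∈ imagPrimitive N) :
    ({q : ℍ[ℤ] | normSq q = p ∧ red p (q * v * star q) ≠ 0}.ncard : ℤ) =
      {u : ℍ[ℤ] | normSq u = 1}.ncard * (p - legendreSym p (-N)) := by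
  have hp : p.Prime := Fact.out
  have h2 := two_ne_zero_zmod hp2
  obtain ⟨hvre, hvN, hvp⟩ := hv
  have hv0 := hvp p hp
  have hvre' : (red p v).re = 0 := by simp [red, hvre]
  have := finite_quaternion (p := p)
  -- Pairs with q x ≡ 0: every `q` has p - 1 partners on its line, every `x` has one unit orbit.
  have hcount := Set.ncard_mul_eq_ncard_mul
    (s := {q : ℍ[ℤ] | normSq q = p ∧ red p (q * v * star q) ≠ 0})
    (t := {x : ℍ[ZMod p] | x.re = 0 ∧ normSq x = 0 ∧ imDot x (red p v) ≠ 0})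
    ((finite_normSq_eq p).subset fun _ h => h.1) (Set.toFinite _)
    (fun q x => red p q * x = 0) (m := p - 1) (n := {u : ℍ[ℤ] | normSq u = 1}.ncard) ?_ ?_
  · rw [ncard_isotropic_imDot_ne_zero hp2 hv0 hvre', normSq_red, hvN] at hcount
    have hp1 : (p : ℤ) - 1 ≠ 0 := by
      have := hp.one_lt
      omega
    refine mul_right_cancel₀ hp1 (hcount.trans ?_)
    rw [legendreSym]
    push_cast
    ring
  · rintro q ⟨hq, hqv⟩
    rw [map_mul, map_mul, red_star] at hqv
    have hq0 := red_ne_zero_of_normSq_eq hq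
    have h := ncard_ker_ne_zero hp2 hq0 (normSq_red_eq_zero hq)
    rw [← Nat.cast_pred hp.pos, ← h]
    congr 2
    ext x
    constructor
    · rintro ⟨⟨h1, h3, h4⟩, h5⟩
      refine ⟨h1, ?_, h5⟩
      rintro rfl
      exact h4 (by simp [imDot, Quaternion.imI_zero, Quaternion.imJ_zero, Quaternion.imK_zero])
    · rintro ⟨h1, h3, h4⟩
      refine ⟨⟨h1, normSq_eq_zero_of_mul_eq_zero hq0 h4, fun h0 => hqv ?_⟩, h4⟩
      exact (conj_eq_zero_iff h2 hq0 h3 h1 hvre' h4).mpr h0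
  · rintro x ⟨hx, hxn, hxv⟩
    have hx0 : x ≠ 0 := by
      rintro rfl
      exact hxv (by simp [imDot, Quaternion.imI_zero, Quaternion.imJ_zero, Quaternion.imK_zero])
    rw [← ncard_mul_eq_zero hp2 hx0 hx hxn]
    congr 2
    ext q
    constructor
    · rintro ⟨⟨h1, -⟩, h3⟩
      exact ⟨h1, h3⟩
    · rintro ⟨h1, h3⟩
      refine ⟨⟨h1, ?_⟩, h3⟩
      rw [map_mul, map_mul, red_star, Ne,
        conj_eq_zero_iff h2 (red_ne_zero_of_normSq_eq h1) hx0 hx hvre' h3]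
      exact hxv

/-- At primes other than `p`, primitivity survives because q*(q v q*)q = p²v. -/
lemma conj_mem_imagPrimitive {N : ℕ} {q v : ℍ[ℤ]} (hq : normSq q = p) (hv : v ∈ imagPrimitive N)
    (h : red p (q * v * star q) ≠ 0) : q * v * star q ∈ imagPrimitive (p ^ 2 * N) := by
  have hp : p.Prime := Fact.out
  obtain ⟨hvre, hvN, hvp⟩ := hv
  refine ⟨?_, ?_, fun r hr h0 => ?_⟩
  · rw [re_conj, hvre, mul_zero]
  · rw [normSq_conj, hq, hvN]
    push_cast
    rfl
  · by_cases hrp : r = p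
    · exact h (hrp ▸ h0)
    have : Fact r.Prime := ⟨hr⟩
    have e : star q * (q * v * star q) * q = (p : ℤ) • (p : ℤ) • v := by
      rw [mul_assoc q, star_mul_self_mul, smul_mul_assoc, mul_star_mul_self, hq]
    have h1 := congrArg (red r) e
    rw [map_mul, map_mul, h0, mul_zero, zero_mul, red_smul, red_smul] at h1
    have hp0 : ((p : ℤ) : ZMod r) ≠ 0 := by
      rw [Int.cast_natCast, Ne, ZMod.natCast_eq_zero_iff]
      exact fun h => hrp ((Nat.prime_dvd_prime_iff_eq hr hp).mp h)
    exact hvp r hr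
      ((smul_eq_zero.mp ((smul_eq_zero.mp h1.symm).resolve_left hp0)).resolve_left hp0)

/-- The candidate is v = q* w q / p². Write w q = p a. Since w² = -p²N, also w a ≡ 0, so `q` and `a`
lie in the totally isotropic right annihilator of `w`; hence `p` divides q* a and p² divides q* w q
= p q* a. -/
lemma exists_eq_conj (hp2 : p ≠ 2) {N : ℕ} {q w : ℍ[ℤ]} (hq : normSq q = p)
    (hw : w ∈ imagPrimitive (p ^ 2 * N)) (h : red p w * red p q = 0) :
    ∃ v ∈ imagPrimitive N, q * v * star q = w := by
  have hp : p.Prime := Fact.out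
  have hp0 : (p : ℤ) ≠ 0 := by exact_mod_cast hp.ne_zero
  obtain ⟨hwre, hwN, hwp⟩ := hw
  obtain ⟨a, ha⟩ := (red_eq_zero_iff p _).mp (by rwa [map_mul])
  have hwa : w * a = (p : ℤ) • (-(N : ℤ)) • q := by
    refine smul_right_injective _ hp0 ?_
    change (p : ℤ) • (w * a) = (p : ℤ) • (p : ℤ) • (-(N : ℤ)) • q
    have h1 := star_mul_self_mul w q
    rw [star_eq_neg_of_re_eq_zero hwre, neg_mul, neg_eq_iff_eq_neg] at h1
    rw [← mul_smul_comm, ← ha, h1, hwN, ← neg_smul, smul_smul, smul_smul]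
    congr 1
    push_cast
    ring
  have hqa : red p (star q * a) = 0 := by
    rw [map_mul, red_star]
    refine star_mul_eq_zero (two_ne_zero_zmod hp2) (hwp p hp) h ?_
    rw [← map_mul, red_eq_zero_iff]
    exact ⟨_, hwa⟩
  obtain ⟨v, hv⟩ := (red_eq_zero_iff p _).mp hqa
  have e : star q * w * q = (p : ℤ) • (p : ℤ) • v := by
    rw [mul_assoc, ha, mul_smul_comm, hv]
  have e' : q * v * star q = w := by
    have h1 : q * (star q * w * q) * star q = (p : ℤ) • (p : ℤ) • w := by
      rw [mul_assoc (star q), mul_star_self_mul, smul_mul_assoc, mul_mul_star_self, hq]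
    rw [e, mul_smul_comm, mul_smul_comm, smul_mul_assoc, smul_mul_assoc] at h1
    exact smul_right_injective _ hp0 (smul_right_injective _ hp0 h1)
  refine ⟨v, ⟨?_, ?_, fun r hr h0 => hwp r hr ?_⟩, e'⟩
  · have h1 := re_conj q v
    rw [e', hwre, hq] at h1
    exact (mul_eq_zero.mp h1.symm).resolve_left hp0
  · have h1 := normSq_conj q v
    rw [e', hwN, hq] at h1
    refine mul_left_cancel₀ (pow_ne_zero 2 hp0) (h1.symm.trans ?_)
    push_cast
    rfl
  · rw [← e', map_mul, map_mul, h0, mul_zero, zero_mul]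

/-- The number of ways of obtaining `w` by conjugation with a quaternion of norm `p`. -/
lemma ncard_conj_fiber (hp2 : p ≠ 2) {N : ℕ} {w : ℍ[ℤ]} (hw : w ∈ imagPrimitive (p ^ 2 * N)) :
    {e : ℍ[ℤ] × ℍ[ℤ] | (normSq e.1 = p ∧ e.2 ∈ imagPrimitive N ∧
      red p (e.1 * e.2 * star e.1) ≠ 0) ∧ e.1 * e.2 * star e.1 = w}.ncard =
      {u : ℍ[ℤ] | normSq u = 1}.ncard := by
  have hp : p.Prime := Fact.out
  have hp0 : (p : ℤ) ≠ 0 := by exact_mod_cast hp.ne_zero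
  obtain ⟨hwre, hwN, hwp⟩ := id hw
  have hwre' : (red p w).re = 0 := by simp [red, hwre]
  rw [← ncard_mul_eq_zero' hp2 (hwp p hp) hwre' (by rw [normSq_red, hwN]; simp),
    -- In the fibre `q` determines `v`, and the `q` that occur are those with w q ≡ 0.
    ← Set.InjOn.ncard_image (f := Prod.fst)]
  · congr 1
    ext q
    constructor
    · rintro ⟨⟨q, v⟩, ⟨⟨hq, hv, hqv⟩, rfl⟩, rfl⟩
      refine ⟨hq, ?_⟩
      change normSq q = p at hq
      change red p (q * v * star q) * red p q = 0
      rw [← map_mul, red_eq_zero_iff]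
      exact ⟨q * v, by rw [mul_star_mul_self, hq]⟩
    · rintro ⟨hq, hqw⟩
      obtain ⟨v, hv, e⟩ := exists_eq_conj hp2 hq hw hqw
      exact ⟨(q, v), ⟨⟨hq, hv, by rw [e]; exact hwp p hp⟩, e⟩, rfl⟩
  · rintro ⟨q, v⟩ ⟨⟨hq, -, -⟩, h1⟩ ⟨q', v'⟩ ⟨-, h2⟩ (rfl : q = q')
    change normSq q = p at hq
    have hq0 : q ≠ 0 := by
      rintro rfl
      rw [map_zero] at hq
      exact hp0 hq.symm
    have h3 : q * v * star q = q * v' * star q := h1.trans h2.symm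
    rw [mul_left_cancel₀ hq0 (mul_right_cancel₀ (star_ne_zero.mpr hq0) h3)]

/-- The Hecke-type recursion for the number of primitive vectors. -/
lemma ncard_imagPrimitive_prime_sq_mul (hp2 : p ≠ 2) (N : ℕ) :
    ((imagPrimitive (p ^ 2 * N)).ncard : ℤ) =
      (p - legendreSym p (-N)) * (imagPrimitive N).ncard := by
  set E : Set (ℍ[ℤ] × ℍ[ℤ]) := {e | normSq e.1 = p ∧ e.2 ∈ imagPrimitive N ∧
      red p (e.1 * e.2 * star e.1) ≠ 0}
  have hEfin : E.Finite := ((finite_normSq_eq p).prod (finite_imagPrimitive N)).subset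
    fun e he => ⟨he.1, he.2.1⟩
  have h1 := Set.ncard_mul_eq_ncard_mul hEfin (finite_imagPrimitive N) (fun e v => e.2 = v)
    (m := 1) (n := {u : ℍ[ℤ] | normSq u = 1}.ncard * (p - legendreSym p (-N))) ?_ ?_
  · have h2 := Set.ncard_mul_eq_ncard_mul hEfin (finite_imagPrimitive (p ^ 2 * N))
      (fun e w => e.1 * e.2 * star e.1 = w)
      (m := 1) (n := {u : ℍ[ℤ] | normSq u = 1}.ncard) ?_ ?_
    · exact mul_left_cancel₀ ncard_units_ne_zero (by linear_combination h1 - h2)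
    · rintro ⟨q, v⟩ ⟨hq, hv, hqv⟩
      have : {w | w ∈ imagPrimitive (p ^ 2 * N) ∧ q * v * star q = w} = {q * v * star q} := by
        ext w
        constructor
        · rintro ⟨-, h⟩
          exact h.symm
        · rintro rfl
          exact ⟨conj_mem_imagPrimitive hq hv hqv, rfl⟩
      rw [this, Set.ncard_singleton, Nat.cast_one]
    · intro w hw
      exact congrArg _ (ncard_conj_fiber hp2 hw)
  · rintro ⟨q, v⟩ ⟨hq, hv, hqv⟩
    have : {w | w ∈ imagPrimitive N ∧ v = w} = {v} := by
      ext w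
      constructor
      · rintro ⟨-, h⟩
        exact h.symm
      · rintro rfl
        exact ⟨hv, rfl⟩
    rw [this, Set.ncard_singleton, Nat.cast_one]
  · intro v hv
    rw [← ncard_conj_ne_zero hp2 hv,
      ← Set.ncard_image_of_injective {q : ℍ[ℤ] | normSq q = p ∧ red p (q * v * star q) ≠ 0}
        (Prod.mk_left_injective v)]
    refine congrArg (fun s : Set (ℍ[ℤ] × ℍ[ℤ]) => (s.ncard : ℤ)) ?_
    ext ⟨q, v'⟩
    constructor
    · rintro ⟨⟨h1, -, h3⟩, rfl⟩
      exact ⟨q, ⟨h1, h3⟩, rfl⟩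
    · rintro ⟨q', ⟨h1, h3⟩, h⟩
      obtain ⟨rfl, rfl⟩ := Prod.mk.inj h
      exact ⟨⟨h1, hv, h3⟩, rfl⟩

end Quaternion
-- Back to vectors, and assembly over the primes dividing `m`.
open Quaternion

lemma Finset.gcd_eq_one_iff_forall_prime {ι : Type*} (s : Finset ι) (v : ι → ℤ) :
    s.gcd v = 1 ↔ ∀ r : ℕ, r.Prime → ¬ ∀ i ∈ s, (r : ℤ) ∣ v i := by
  constructor
  · intro h r hr hd
    have h1 : (r : ℤ) ∣ s.gcd v := Finset.dvd_gcd hd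
    rw [h] at h1
    exact hr.one_lt.ne' (by exact_mod_cast Int.eq_one_of_dvd_one (by positivity) h1)
  · intro h
    rw [← Finset.normalize_gcd, normalize_eq_one, Int.isUnit_iff_natAbs_eq]
    by_contra hc
    obtain ⟨r, hr, hd⟩ := Nat.exists_prime_and_dvd hc
    exact h r hr fun i hi => (Int.natCast_dvd.mpr hd).trans (Finset.gcd_dvd hi)

lemma red_ofComponents_eq_zero_iff (r : ℕ) (v : Fin 3 → ℤ) :
    red r (ofComponents 0 (v 0) (v 1) (v 2)) = 0 ↔ ∀ i ∈ Finset.univ, (r : ℤ) ∣ v i := by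
  rw [red_eq_zero_iff]
  constructor
  · rintro ⟨c, hc⟩ i -
    have h1 := congrArg QuaternionAlgebra.imI hc
    have h2 := congrArg QuaternionAlgebra.imJ hc
    have h3 := congrArg QuaternionAlgebra.imK hc
    fin_cases i
    · exact ⟨c.imI, h1⟩
    · exact ⟨c.imJ, h2⟩
    · exact ⟨c.imK, h3⟩
  · intro h
    choose c hc using fun i => h i (Finset.mem_univ i)
    refine ⟨ofComponents 0 (c 0) (c 1) (c 2), ?_⟩
    ext
    · simp
    · exact hc 0
    · exact hc 1
    · exact hc 2

lemma primitiveCount_eq_ncard_imagPrimitive (N : ℕ) :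
    primitiveCount N = (imagPrimitive N).ncard := by
  have hinj : Function.Injective
      (fun v : Fin 3 → ℤ => ofComponents 0 (v 0) (v 1) (v 2)) := fun v w h => by
    funext i
    fin_cases i
    · exact congrArg QuaternionAlgebra.imI h
    · exact congrArg QuaternionAlgebra.imJ h
    · exact congrArg QuaternionAlgebra.imK h
  have hmem (v : Fin 3 → ℤ) : v ∈ primitiveVectors N ↔
      ofComponents 0 (v 0) (v 1) (v 2) ∈ imagPrimitive N := by
    change (∑ i, v i ^ 2 = (N : ℤ) ∧ Finset.univ.gcd v = 1) ↔
      ((0 : ℤ) = 0 ∧ normSq (ofComponents 0 (v 0) (v 1) (v 2)) = N ∧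
        ∀ r : ℕ, r.Prime → red r (ofComponents 0 (v 0) (v 1) (v 2)) ≠ 0)
    simp only [Ne, red_ofComponents_eq_zero_iff, Finset.gcd_eq_one_iff_forall_prime,
      normSq_ofComponents, Fin.sum_univ_three]
    simp
  rw [primitiveCount, ← Set.ncard_image_of_injective _ hinj]
  congr 1
  ext q
  constructor
  · rintro ⟨v, hv, rfl⟩
    exact (hmem v).mp hv
  · intro hq
    have e : ofComponents 0 (![q.imI, q.imJ, q.imK] 0) (![q.imI, q.imJ, q.imK] 1)
        (![q.imI, q.imJ, q.imK] 2) = q := by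
      ext
      · exact hq.1.symm
      all_goals rfl
    exact ⟨![q.imI, q.imJ, q.imK], (hmem _).mpr (by rwa [e]), e⟩

/-- Squares are 0 or 1 modulo 4, so three of them with sum divisible by 4 are all even. -/
lemma primitiveCount_eq_zero_of_four_dvd {N : ℕ} (h : 4 ∣ N) : primitiveCount N = 0 := by
  have : primitiveVectors N = ∅ := by
    rw [Set.eq_empty_iff_forall_notMem]
    rintro v ⟨hv, hg⟩
    rw [Finset.gcd_eq_one_iff_forall_prime] at hg
    refine hg 2 Nat.prime_two ?_
    have e (t : ℤ) : t ^ 2 % 4 = t % 2 := by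
      rcases Int.even_or_odd' t with ⟨k, rfl | rfl⟩
      · ring_nf
        omega
      · ring_nf
        omega
    rw [Fin.sum_univ_three] at hv
    have h0 := e (v 0)
    have h1 := e (v 1)
    have h2 := e (v 2)
    intro i _
    push_cast
    fin_cases i <;> simp only [Fin.zero_eta, Fin.mk_one, Fin.reduceFinMk] <;> omega
  rw [primitiveCount, this, Set.ncard_empty]

/-- `jacobiSym` needs no primality instance, so it can stand inside a product over `m.primeFactors`.
-/
lemma primitiveCount_prime_sq_mul {p : ℕ} (hp : p.Prime) (hp2 : p ≠ 2) (N : ℕ) :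
    (primitiveCount (p ^ 2 * N) : ℤ) = (p - jacobiSym (-N) p) * primitiveCount N := by
  have : Fact p.Prime := ⟨hp⟩
  rw [primitiveCount_eq_ncard_imagPrimitive, primitiveCount_eq_ncard_imagPrimitive,
    ncard_imagPrimitive_prime_sq_mul hp2, jacobiSym.legendreSym.to_jacobiSym]

lemma primitiveCount_mul_prime_pow_sq {p : ℕ} (hp : p.Prime) (hp2 : p ≠ 2) (N l : ℕ) :
    (primitiveCount (N * (p ^ (l + 1)) ^ 2) : ℤ) =
      primitiveCount N * (p ^ (l + 1) - jacobiSym (-N) p * p ^ l) := by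
  induction l with
  | zero =>
    have h := primitiveCount_prime_sq_mul hp hp2 N
    rw [zero_add, pow_one, mul_comm N, h]
    ring
  | succ l ih =>
    have : Fact p.Prime := ⟨hp⟩
    -- After the first step `p` divides the norm, the symbol vanishes, and each further step
    -- multiplies by `p` alone.
    have hz : jacobiSym (-((N * (p ^ (l + 1)) ^ 2 : ℕ) : ℤ)) p = 0 := by
      rw [← jacobiSym.legendreSym.to_jacobiSym, legendreSym.eq_zero_iff]
      simp
    rw [show N * (p ^ (l + 1 + 1)) ^ 2 = p ^ 2 * (N * (p ^ (l + 1)) ^ 2) by ring,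
      primitiveCount_prime_sq_mul hp hp2, hz, ih]
    ring

lemma jacobiSym_neg_mul_sq {p : ℕ} (hp : p.Prime) (N : ℕ) {a : ℕ} (ha : ¬ p ∣ a) :
    jacobiSym (-((N * a ^ 2 : ℕ) : ℤ)) p = jacobiSym (-N) p := by
  have h : Int.gcd a p = 1 := by
    rw [Int.gcd_natCast_natCast]
    exact ((Nat.Prime.coprime_iff_not_dvd hp).mpr ha).symm
  rw [show (-((N * a ^ 2 : ℕ) : ℤ)) = -N * (a : ℤ) ^ 2 by push_cast; ring,
    jacobiSym.mul_left, jacobiSym.sq_one' h, mul_one]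

/-- `N` must vary in the induction: for coprime `a` and `b`, the factor of `b` is taken at N a²,
whose symbols at the primes of `b` agree with those of `N`. -/
lemma primitiveCount_mul_sq_of_odd (m : ℕ) (hm : Odd m) (N : ℕ) :
    (primitiveCount (N * m ^ 2) : ℤ) = primitiveCount N *
      ∏ p ∈ m.primeFactors, ((p : ℤ) ^ m.factorization p -
        jacobiSym (-N) p * (p : ℤ) ^ (m.factorization p - 1)) := by
  induction m using Nat.recOnPosPrimePosCoprime generalizing N with
  | zero => simp at hm
  | one => simp
  | prime_pow p l hp hl =>
    have hp2 : p ≠ 2 := by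
      rintro rfl
      exact Nat.not_odd_iff_even.mpr (even_two.pow_of_ne_zero hl.ne') hm
    obtain ⟨l, rfl⟩ : ∃ k, l = k + 1 := ⟨l - 1, by omega⟩
    rw [primitiveCount_mul_prime_pow_sq hp hp2, Nat.primeFactors_prime_pow l.succ_ne_zero hp,
      Finset.prod_singleton, hp.factorization_pow]
    simp
  | coprime a b ha hb hab iha ihb =>
    obtain ⟨hao, hbo⟩ := Nat.odd_mul.mp hm
    rw [mul_pow, ← mul_assoc, ihb hbo, iha hao, hab.primeFactors_mul,
      Finset.prod_union hab.disjoint_primeFactors, mul_assoc]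
    congr 2
    · refine Finset.prod_congr rfl fun p hp => ?_
      rw [Nat.factorization_eq_of_coprime_left hab (by simpa using hp)]
    · refine Finset.prod_congr rfl fun p hp => ?_
      rw [Nat.factorization_eq_of_coprime_right hab (by simpa using hp)]
      have hpp := Nat.prime_of_mem_primeFactors hp
      rw [jacobiSym_neg_mul_sq hpp]
      exact fun h => hpp.one_lt.ne'
        (Nat.eq_one_of_dvd_coprimes hab h (Nat.dvd_of_mem_primeFactors hp))

theorem theorem4p8 (m n : ℕ) (hm : 1 ≤ m) (hn : 1 ≤ n) (hsq : Squarefree n) :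
    (Odd m →
      (primitiveCount (n * m ^ 2) : ℤ) =
        (primitiveCount n : ℤ) *
          ∏ p ∈ m.primeFactors.attach,
            ((p.1 : ℤ) ^ (m.factorization p.1) -
              legendreSymbol (-(n : ℤ)) p.1 (Nat.prime_of_mem_primeFactors p.2) *
                (p.1 : ℤ) ^ (m.factorization p.1 - 1))) ∧
    (Even m → primitiveCount (n * m ^ 2) = 0) := by
  constructor
  · intro ho
    rw [primitiveCount_mul_sq_of_odd m ho, ← Finset.prod_attach]
    congr 1
    refine Finset.prod_congr rfl fun p _ => ?_
    have : Fact p.1.Prime := ⟨Nat.prime_of_mem_primeFactors p.2⟩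
    rw [← jacobiSym.legendreSym.to_jacobiSym, legendreSymbol]
  · rintro he
    refine primitiveCount_eq_zero_of_four_dvd (Dvd.dvd.mul_left ?_ n)
    obtain ⟨k, rfl⟩ := he
    exact ⟨k ^ 2, by ring⟩
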